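/- Let $\mathbb S^1=\mathbb R/\mathbb Z$ be the circle (the unit interval with identified end points), and let $C^1(\mathbb S^1)$ be the space of continuously differentiable functions $f:\mathbb S^1\to\mathbb R$, each regarded as the vector field of the dynamical system $\dot x=f(x)$ on $\mathbb S^1$, with the $C^1$ norm $$\|f\|_1=\sup_{x\in\mathbb S^1}|f(x)|+\sup_{x\in\mathbb S^1}|f'(x)|.$$ Two systems $\dot x=f(x)$ and $\dot y=g(y)$ with $f,g\in C^1(\mathbb S^1)$ are called topologically equivalent if there is a homeomorphism $h:\mathbb S^1\to\mathbb S^1$ that maps the orbits of the first system, oriented by increasing time, onto the oriented orbits of the second; that is, for every solution $\gamma:\mathbb R\to\mathbb S^1$ of the first system there is an increasing homeomorphism $\tau:\mathbb R\to\mathbb R$ such that $t\mapsto h(\gamma(\tau(t)))$ is a solution of the second. The system $\dot x=f(x)$ is called $C^1$-structurally stable if for every sufficiently small $\epsilon>0$ it is topologically equivalent to $\dot y=g(y)$ for every $g\in C^1(\mathbb S^1)$ with $\|g-f\|_1<\epsilon$. Theorem. The set of all $f\in C^1(\mathbb S^1)$ for which $\dot x=f(x)$ is $C^1$-structurally stable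 is open and dense in $C^1(\mathbb S^1)$ with respect to the $C^1$ norm. -/

import Mathlib

namespace CircleDynamics

/-- `C¹(𝕊¹)`: the `C¹` vector fields on the circle `𝕊¹ = ℝ/ℤ` (the unit interval with its
end points identified). As the tangent bundle of `ℝ/ℤ` is trivial, such a vector field is a
function `ℝ/ℤ → ℝ`; it is of class `C¹` if the 1-periodic function on `ℝ` that it induces is. -/
structure C1Circle where
  /-- the underlying function on the circle -/
  toFun : UnitAddCircle → ℝ
  contDiff_toFun : ContDiff ℝ 1 (fun t : ℝ => toFun (t : UnitAddCircle))

namespace C1Circle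

instance : CoeFun C1Circle (fun _ => UnitAddCircle → ℝ) := ⟨C1Circle.toFun⟩

theorem toFun_injective : Function.Injective C1Circle.toFun := by
  rintro ⟨f, hf⟩ ⟨g, hg⟩ h
  cases h
  rfl

instance : Zero C1Circle := ⟨⟨fun _ => 0, contDiff_const⟩⟩
instance : Add C1Circle := ⟨fun f g => ⟨fun x => f x + g x, f.2.add g.2⟩⟩
instance : Neg C1Circle := ⟨fun f => ⟨fun x => -f x, f.2.neg⟩⟩
instance : Sub C1Circle := ⟨fun f g => ⟨fun x => f x - g x, f.2.sub g.2⟩⟩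
instance : SMul ℕ C1Circle := ⟨fun n f => ⟨fun x => n • f x, f.2.const_smul n⟩⟩
instance : SMul ℤ C1Circle := ⟨fun n f => ⟨fun x => n • f x, f.2.const_smul n⟩⟩

instance : AddCommGroup C1Circle :=
  toFun_injective.addCommGroup _ rfl (fun _ _ => rfl) (fun _ => rfl) (fun _ _ => rfl)
    (fun _ _ => rfl) (fun _ _ => rfl)

/-- The derivative `f' : 𝕊¹ → ℝ` of a function on the circle. -/
noncomputable def derivative (f : C1Circle) (x : UnitAddCircle) : ℝ :=
  deriv (fun t : ℝ => f (x + (t : UnitAddCircle))) 0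

theorem derivative_coe (f : C1Circle) (s : ℝ) :
    f.derivative (s : UnitAddCircle) = deriv (fun t : ℝ => f (t : UnitAddCircle)) s := by
  have h := deriv_comp_const_add (fun t : ℝ => f (t : UnitAddCircle)) s 0
  simpa [derivative] using h

theorem continuous_toFun (f : C1Circle) : Continuous f.toFun := by
  refine (QuotientAddGroup.isQuotientMap_mk (N := AddSubgroup.zmultiples (1 : ℝ))).continuous_iff.2
    ?_
  exact f.2.continuous

theorem continuous_derivative (f : C1Circle) : Continuous f.derivative := by
  refine (QuotientAddGroup.isQuotientMap_mk (N := AddSubgroup.zmultiples (1 : ℝ))).continuous_iff.2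
    ?_
  have h : f.derivative ∘ (QuotientAddGroup.mk : ℝ → ℝ ⧸ AddSubgroup.zmultiples (1 : ℝ))
      = deriv (fun t : ℝ => f (t : UnitAddCircle)) := funext f.derivative_coe
  rw [h]
  exact f.2.continuous_deriv (by norm_num)

theorem differentiableAt (f : C1Circle) (x : UnitAddCircle) :
    DifferentiableAt ℝ (fun t : ℝ => f (x + (t : UnitAddCircle))) 0 := by
  induction x using QuotientAddGroup.induction_on with
  | H s =>
    have h : DifferentiableAt ℝ (fun t : ℝ => f ((s + t : ℝ) : UnitAddCircle)) 0 :=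
      ((f.2.differentiable (by norm_num)).comp (differentiable_id.const_add s)) 0
    simpa using h

theorem derivative_add (f g : C1Circle) (x : UnitAddCircle) :
    (f + g).derivative x = f.derivative x + g.derivative x :=
  deriv_fun_add (f.differentiableAt x) (g.differentiableAt x)

theorem derivative_neg (f : C1Circle) (x : UnitAddCircle) :
    (-f).derivative x = -f.derivative x :=
  deriv.fun_neg

theorem bddAbove_abs {u : UnitAddCircle → ℝ} (hu : Continuous u) :
    BddAbove (Set.range fun x => |u x|) :=
  (isCompact_range hu.abs).bddAbove

theorem iSup_abs_add_le {u v : UnitAddCircle → ℝ} (hu : Continuous u) (hv : Continuous v) :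
    (⨆ x, |u x + v x|) ≤ (⨆ x, |u x|) + ⨆ x, |v x| :=
  ciSup_le fun x => (abs_add_le _ _).trans
    (add_le_add (le_ciSup (bddAbove_abs hu) x) (le_ciSup (bddAbove_abs hv) x))

/-- The `C¹` norm `‖f‖₁ = sup |f| + sup |f'|`. -/
noncomputable def c1Norm (f : C1Circle) : ℝ :=
  (⨆ x : UnitAddCircle, |f x|) + ⨆ x : UnitAddCircle, |f.derivative x|

/-- The topology of `C¹(𝕊¹)` is that of the `C¹` norm. -/
noncomputable instance : NormedAddCommGroup C1Circle :=
  AddGroupNorm.toNormedAddCommGroup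
    { toFun := c1Norm
      map_zero' := by
        have h : ∀ x, (0 : C1Circle).derivative x = 0 := fun x => deriv_const 0 (0 : ℝ)
        have h0 : ∀ x, (0 : C1Circle) x = 0 := fun _ => rfl
        simp [c1Norm, h, h0]
      add_le' := fun f g => by
        have h1 := iSup_abs_add_le f.continuous_toFun g.continuous_toFun
        have h2 := iSup_abs_add_le f.continuous_derivative g.continuous_derivative
        have h3 : c1Norm (f + g) = (⨆ x : UnitAddCircle, |f x + g x|)
            + ⨆ x : UnitAddCircle, |f.derivative x + g.derivative x| := by
          simp only [c1Norm, derivative_add]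
          rfl
        rw [h3]
        unfold c1Norm
        linarith
      neg' := fun f => by
        have h0 : ∀ x, (-f) x = -f x := fun _ => rfl
        simp [c1Norm, derivative_neg, h0]
      eq_zero_of_map_eq_zero' := fun f hf => by
        have h1 : 0 ≤ ⨆ x : UnitAddCircle, |f.derivative x| :=
          Real.iSup_nonneg fun _ => abs_nonneg _
        apply toFun_injective
        funext x
        have h2 : |f x| ≤ ⨆ x : UnitAddCircle, |f x| :=
          le_ciSup (bddAbove_abs f.continuous_toFun) x
        have h3 : (⨆ x : UnitAddCircle, |f x|) + (⨆ x : UnitAddCircle, |f.derivative x|) = 0 := hf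
        exact abs_eq_zero.1 (le_antisymm (by linarith) (abs_nonneg _)) }

theorem norm_def (f : C1Circle) :
    ‖f‖ = (⨆ x : UnitAddCircle, |f x|) + ⨆ x : UnitAddCircle, |f.derivative x| := rfl

end C1Circle

/-- `γ : ℝ → 𝕊¹` is a solution, defined for all times, of `ẋ = f(x)` on the circle: it has a lift
to `ℝ` whose derivative at each time `t` is `f (γ t)`. -/
def IsSolution (f : C1Circle) (γ : ℝ → UnitAddCircle) : Prop :=
  ∃ x : ℝ → ℝ, (∀ t, γ t = (x t : UnitAddCircle)) ∧ ∀ t, HasDerivAt x (f (γ t)) t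

/-- The homeomorphism `h` maps the orbits of `ẋ = f(x)`, oriented by increasing time, onto the
oriented orbits of `ẏ = g(y)`: the image under `h` of any solution of the first system is, after an
increasing reparametrization `τ` of the whole time axis, a solution of the second. -/
def IsTopologicalEquivalence (h : UnitAddCircle ≃ₜ UnitAddCircle) (f g : C1Circle) : Prop :=
  ∀ γ : ℝ → UnitAddCircle, IsSolution f γ →
    ∃ τ : ℝ ≃o ℝ, IsSolution g (fun t => h (γ (τ t)))

/-- The systems `ẋ = f(x)` and `ẏ = g(y)` are topologically equivalent. -/
def TopologicallyEquivalent (f g : C1Circle) : Prop :=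
  ∃ h : UnitAddCircle ≃ₜ UnitAddCircle, IsTopologicalEquivalence h f g

/-- `ẋ = f(x)` is `C¹` structurally stable: for all sufficiently small `ε > 0` it is topologically
equivalent to each system `ẏ = g(y)` with `‖g - f‖₁ < ε`. -/
def StructurallyStable (f : C1Circle) : Prop :=
  ∃ ε₀ > 0, ∀ ε, 0 < ε → ε ≤ ε₀ → ∀ g : C1Circle, ‖g - f‖ < ε → TopologicallyEquivalent f g

/-- `SS¹(𝕊¹)`: the set of `C¹` structurally stable systems in `C¹(𝕊¹)`. -/
def SS1 : Set C1Circle := {f | StructurallyStable f}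

end CircleDynamics

/-!
A vector field on the circle is structurally stable as soon as all its zeros are simple, and such
fields are dense. Openness is formal once topological equivalence is known to be an equivalence
relation: a field near a stable `f` is equivalent to `f`, hence to all fields near `f`.

*Equivalence relation* (`TopologicallyEquivalent.symm`, `TopologicallyEquivalent.trans`). Only
symmetry needs an argument. As the fields are `C¹`, solutions through a point exist for all times
and are unique (`exists_isSolution`, `IsSolution.eq_of_apply_zero_eq`), so every solution of the
second system is the reparametrized image of a solution of the first.

*Density* (`dense_SS1`). By Sard's theorem `f` has arbitrarily small regular values `v > 0`, and
the zeros of `f - v` are then simple.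

*Stability* (`structurallyStable_of_simple_zeros`). An increasing homeomorphism `H` of `ℝ` with
`sign (G (H x)) = sign (F x)` maps the orbits of `x' = F x` onto those of `y' = G y`, with their
orientation (`exists_reparametrization`): a nonconstant orbit is a whole component of the set where
the field does not vanish, and solutions traverse it monotonically. On the circle `H` is taken of
the form `p ↦ p + s p` with `s` a small `1 / 2`-Lipschitz function
(`topologicallyEquivalent_of_sign_eq`). If the zeros of `f` are simple and `g` is `C¹`-close to `f`,
each zero of `f` has a single zero of `g` next to it; the displacements define `s` on the zero set
of `f`, where they are `1 / 2`-Lipschitz because the zeros are uniformly separated, and `s` extends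
to the circle by McShane's theorem. Neither the number nor the cyclic order of the zeros is needed,
and fields without zeros are included.
-/

namespace CircleDynamics

open Set Filter Topology MeasureTheory
open scoped NNReal

/-! ### Scalar autonomous differential equations -/

/-- A bounded Lipschitz vector field on `ℝ` has a global solution through every point. The
solutions on the intervals `[-T, T]` given by the Picard-Lindelöf theorem agree by uniqueness, so
that `t ↦ α (|t| + 1) t` is a solution on all of `ℝ`. -/
theorem exists_global_solution {F : ℝ → ℝ} {K L : ℝ≥0} (hF : LipschitzWith K F)
    (hL : ∀ x, |F x| ≤ L) (x₀ : ℝ) :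
    ∃ x : ℝ → ℝ, x 0 = x₀ ∧ ∀ t, HasDerivAt x (F (x t)) t := by
  have local_sol : ∀ T : ℝ, ∃ α : ℝ → ℝ, 0 < T →
      α 0 = x₀ ∧ ∀ t ∈ Ioo (-T) T, HasDerivAt α (F (α t)) t := by
    intro T
    by_cases hT : 0 < T
    swap
    · exact ⟨0, fun h => absurd h hT⟩
    have h0 : (0 : ℝ) ∈ Icc (-T) T := ⟨by linarith, hT.le⟩
    have hPL : IsPicardLindelof (fun _ => F) (⟨0, h0⟩ : Icc (-T) T) x₀ (L * T.toNNReal) 0 L K :=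
      .of_time_independent (fun x _ => hL x) (hF.lipschitzOnWith) (by simp [hT.le])
    obtain ⟨α, hα, hα'⟩ := hPL.exists_eq_forall_mem_Icc_hasDerivWithinAt₀
    exact ⟨α, fun _ => ⟨hα, fun t ht =>
      (hα' t (Ioo_subset_Icc_self ht)).hasDerivAt (Icc_mem_nhds ht.1 ht.2)⟩⟩
  choose α hα using local_sol
  have agree : ∀ S T t : ℝ, |t| < S → S ≤ T → α S t = α T t := by
    intro S T t ht hST
    have hS : 0 < S := (abs_nonneg t).trans_lt ht
    have hsub : Ioo (-S) S ⊆ Ioo (-T) T := Ioo_subset_Ioo (by linarith) hST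
    exact ODE_solution_unique_of_mem_Ioo (v := fun _ => F) (s := fun _ => univ) (t₀ := 0)
      (fun _ _ => hF.lipschitzOnWith) ⟨by linarith, hS⟩
      (fun t ht => ⟨(hα S hS).2 t ht, trivial⟩)
      (fun t ht => ⟨(hα T (hS.trans_le hST)).2 t (hsub ht), trivial⟩)
      ((hα S hS).1.trans (hα T (hS.trans_le hST)).1.symm) (abs_lt.1 ht)
  refine ⟨fun t => α (|t| + 1) t, (hα _ (by positivity)).1, fun t => ?_⟩
  have hmem : t ∈ Ioo (-(|t| + 1)) (|t| + 1) := abs_lt.1 (lt_add_one _)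
  refine ((hα (|t| + 1) (by positivity)).2 t hmem).congr_of_eventuallyEq ?_
  filter_upwards [Ioo_mem_nhds hmem.1 hmem.2] with s hs
  rcases le_total |s| |t| with h | h
  · exact agree _ _ _ (lt_add_one _) (by linarith)
  · exact (agree _ _ _ (abs_lt.2 hs) (by linarith)).symm

/-- A solution that meets a zero of a Lipschitz vector field stays there. -/
theorem solution_eq_const {F x : ℝ → ℝ} {K : ℝ≥0} (hF : LipschitzWith K F)
    (hx : ∀ t, HasDerivAt x (F (x t)) t) {t : ℝ} (ht : F (x t) = 0) (r : ℝ) : x r = x t :=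
  congrFun (ODE_solution_unique_univ (v := fun _ => F) (s := fun _ => univ) (t₀ := t)
    (g := fun _ => x t) (fun _ => hF.lipschitzOnWith) (fun r => ⟨hx r, trivial⟩)
    (fun r => ⟨by rw [ht]; exact hasDerivAt_const r (x t), trivial⟩) rfl) r

/-- Solutions of a Lipschitz equation do not run into a zero of the vector field, so a solution that
starts where the vector field is positive stays where it is positive. -/
theorem solution_pos {F x : ℝ → ℝ} {K : ℝ≥0} (hF : LipschitzWith K F)
    (hx : ∀ t, HasDerivAt x (F (x t)) t) (h0 : 0 < F (x 0)) (t : ℝ) : 0 < F (x t) := by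
  have hne : ∀ t, F (x t) ≠ 0 := by
    intro t ht
    rw [solution_eq_const hF hx ht 0, ht] at h0
    exact h0.false
  have hc : Continuous fun t => F (x t) :=
    hF.continuous.comp (continuous_iff_continuousAt.2 fun t => (hx t).continuousAt)
  by_contra hle
  obtain ⟨r, hr⟩ := mem_range_of_exists_le_of_exists_ge hc ⟨t, not_lt.1 hle⟩ ⟨0, h0.le⟩
  exact hne r hr

theorem solution_strictMono {F x : ℝ → ℝ} {K : ℝ≥0} (hF : LipschitzWith K F)
    (hx : ∀ t, HasDerivAt x (F (x t)) t) (h0 : 0 < F (x 0)) : StrictMono x :=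
  strictMono_of_hasDerivAt_pos hx fun t => solution_pos hF hx h0 t

/-- Away from the zeros of the vector field, the speed of a solution is bounded below on compact
sets, so the solution reaches every point that no zero separates from its initial value. -/
theorem exists_eq_of_pos_of_le {F x : ℝ → ℝ} {K : ℝ≥0} (hF : LipschitzWith K F)
    (hx : ∀ t, HasDerivAt x (F (x t)) t) {p : ℝ} (hp : x 0 ≤ p)
    (hpos : ∀ q ∈ Icc (x 0) p, 0 < F q) : ∃ t, x t = p := by
  have hxc : Continuous x := continuous_iff_continuousAt.2 fun t => (hx t).continuousAt
  have hmono := (solution_strictMono hF hx (hpos _ ⟨le_rfl, hp⟩)).monotone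
  by_contra hne
  push Not at hne
  have hlt : ∀ t, x t < p := by
    intro t
    by_contra hle
    obtain ⟨s, hs⟩ := mem_range_of_exists_le_of_exists_ge hxc ⟨0, hp⟩ ⟨t, not_lt.1 hle⟩
    exact hne s hs
  obtain ⟨q, hq, hmin⟩ := isCompact_Icc.exists_isMinOn (nonempty_Icc.2 hp)
    hF.continuous.continuousOn
  have hm := hpos q hq
  have hT : 0 ≤ (p - x 0) / F q := div_nonneg (by linarith) hm.le
  have hgrow := (convex_Ici (0 : ℝ)).mul_sub_le_image_sub_of_le_deriv hxc.continuousOn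
    (fun t _ => (hx t).differentiableAt.differentiableWithinAt) (C := F q)
    (fun t ht => by
      rw [interior_Ici] at ht
      rw [(hx t).deriv]
      exact hmin ⟨hmono (le_of_lt ht), (hlt t).le⟩)
    0 self_mem_Ici _ hT hT
  rw [sub_zero, mul_div_cancel₀ _ hm.ne'] at hgrow
  linarith [hlt ((p - x 0) / F q)]

theorem exists_eq_of_pos {F x : ℝ → ℝ} {K : ℝ≥0} (hF : LipschitzWith K F)
    (hx : ∀ t, HasDerivAt x (F (x t)) t) {p : ℝ}
    (hpos : ∀ q ∈ uIcc (x 0) p, 0 < F q) : ∃ t, x t = p := by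
  rcases le_total (x 0) p with hp | hp
  · exact exists_eq_of_pos_of_le hF hx hp (by rwa [uIcc_of_le hp] at hpos)
  · -- Reversing both time and space leaves the vector field positive.
    rw [uIcc_of_ge hp] at hpos
    have hF' : LipschitzWith K fun y => F (-y) := by
      simpa using! hF.comp (LipschitzWith.id.neg)
    have hx' : ∀ t, HasDerivAt (fun t => -x (-t)) (F (- -x (-t))) t := by
      intro t
      simpa using! ((hx (-t)).scomp t (hasDerivAt_neg t)).neg
    obtain ⟨t, ht⟩ := exists_eq_of_pos_of_le (F := fun y => F (-y)) hF' hx' (p := -p)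
      (by simpa using hp) (fun q hq => hpos _ (by
        simp only [neg_zero] at hq
        exact ⟨by linarith [hq.2], by linarith [hq.1]⟩))
    exact ⟨-t, neg_injective ht⟩

/-- An increasing homeomorphism `H` that matches the signs of the vector fields maps the orbits of
the first onto those of the second, here for an orbit along which the vector field is positive. -/
theorem exists_reparametrization_of_pos {F G x y : ℝ → ℝ} {K L : ℝ≥0} (hF : LipschitzWith K F)
    (hG : LipschitzWith L G) (H : ℝ ≃o ℝ)
    (hsign : ∀ p, SignType.sign (G (H p)) = SignType.sign (F p))
    (hx : ∀ t, HasDerivAt x (F (x t)) t) (hy : ∀ t, HasDerivAt y (G (y t)) t)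
    (h0 : y 0 = H (x 0)) (hpos : 0 < F (x 0)) :
    ∃ τ : ℝ ≃o ℝ, ∀ t, H (x (τ t)) = y t := by
  have hiff : ∀ p, 0 < G (H p) ↔ 0 < F p := fun p => by
    rw [← sign_eq_one_iff, hsign, sign_eq_one_iff]
  have hposG : 0 < G (y 0) := by rw [h0]; exact (hiff _).2 hpos
  have hxm := solution_strictMono hF hx hpos
  have hym := solution_strictMono hG hy hposG
  have hxc : Continuous x := continuous_iff_continuousAt.2 fun t => (hx t).continuousAt
  have hyc : Continuous y := continuous_iff_continuousAt.2 fun t => (hy t).continuousAt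
  have reach_x : ∀ t, ∃ s, x s = H.symm (y t) := by
    intro t
    refine exists_eq_of_pos hF hx fun q hq => (hiff q).1 ?_
    have hHq : H q ∈ uIcc (y 0) (y t) := by
      have := H.monotone.image_uIcc_subset (mem_image_of_mem H hq)
      rwa [← h0, H.apply_symm_apply] at this
    obtain ⟨r, -, hr⟩ := intermediate_value_uIcc hyc.continuousOn hHq
    rw [← hr]
    exact solution_pos hG hy hposG r
  have reach_y : ∀ s, ∃ t, y t = H (x s) := by
    intro s
    refine exists_eq_of_pos hG hy fun q hq => ?_
    rw [← H.apply_symm_apply q, hiff]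
    have hHq : H.symm q ∈ uIcc (x 0) (x s) := by
      have := H.symm.monotone.image_uIcc_subset (mem_image_of_mem H.symm hq)
      rwa [h0, H.symm_apply_apply, H.symm_apply_apply] at this
    obtain ⟨r, -, hr⟩ := intermediate_value_uIcc hxc.continuousOn hHq
    rw [← hr]
    exact solution_pos hF hx hpos r
  choose τ hτ using reach_x
  have hτ' : ∀ t, H (x (τ t)) = y t := fun t => by rw [hτ, H.apply_symm_apply]
  have hτm : StrictMono τ := fun a b hab =>
    hxm.lt_iff_lt.1 (H.lt_iff_lt.1 (by rw [hτ', hτ']; exact hym hab))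
  have hτs : Function.Surjective τ := fun s => by
    obtain ⟨t, ht⟩ := reach_y s
    exact ⟨t, hxm.injective (H.injective ((hτ' t).trans ht))⟩
  exact ⟨hτm.orderIsoOfSurjective τ hτs, hτ'⟩

/-- An increasing homeomorphism that matches the signs of the vector fields maps every orbit of the
first onto an orbit of the second, constant orbits and negative speeds included. -/
theorem exists_reparametrization {F G x y : ℝ → ℝ} {K L : ℝ≥0} (hF : LipschitzWith K F)
    (hG : LipschitzWith L G) (H : ℝ ≃o ℝ)
    (hsign : ∀ p, SignType.sign (G (H p)) = SignType.sign (F p))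
    (hx : ∀ t, HasDerivAt x (F (x t)) t) (hy : ∀ t, HasDerivAt y (G (y t)) t)
    (h0 : y 0 = H (x 0)) :
    ∃ τ : ℝ ≃o ℝ, ∀ t, H (x (τ t)) = y t := by
  rcases lt_trichotomy (F (x 0)) 0 with hneg | hzero | hpos
  · -- Reversing time in both equations makes the vector fields positive on these orbits.
    have rev : ∀ {E z : ℝ → ℝ}, (∀ t, HasDerivAt z (E (z t)) t) →
        ∀ t, HasDerivAt (fun t => z (-t)) (-E (z (-t))) t := fun {E z} hz t => by
      simpa using! (hz (-t)).scomp t (hasDerivAt_neg t)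
    obtain ⟨τ, hτ⟩ := exists_reparametrization_of_pos (F := fun q => -F q) (G := fun q => -G q)
      hF.neg hG.neg H (fun p => by rw [Left.sign_neg, Left.sign_neg, hsign]) (rev hx) (rev hy)
      (by simpa using h0) (by simpa using hneg)
    refine ⟨((OrderIso.neg ℝ).trans τ.dual).trans (OrderIso.neg ℝ).symm, fun t => ?_⟩
    simpa using! hτ (-t)
  · have hzero' : G (y 0) = 0 := by
      rw [h0, ← sign_eq_zero_iff, hsign, sign_eq_zero_iff, hzero]
    refine ⟨OrderIso.refl ℝ, fun t => ?_⟩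
    rw [solution_eq_const hG hy hzero' t, h0, OrderIso.refl_apply, solution_eq_const hF hx hzero t]
  · exact exists_reparametrization_of_pos hF hG H hsign hx hy h0 hpos

/-! ### The flow of a vector field on the circle -/

namespace C1Circle

theorem abs_apply_le_norm (f : C1Circle) (p : UnitAddCircle) : |f p| ≤ ‖f‖ := by
  have h1 := le_ciSup (bddAbove_abs f.continuous_toFun) p
  have h2 : 0 ≤ ⨆ x : UnitAddCircle, |f.derivative x| := Real.iSup_nonneg fun _ => abs_nonneg _
  rw [norm_def]
  linarith

theorem abs_derivative_le_norm (f : C1Circle) (p : UnitAddCircle) : |f.derivative p| ≤ ‖f‖ := by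
  have h1 := le_ciSup (bddAbove_abs f.continuous_derivative) p
  have h2 : 0 ≤ ⨆ x : UnitAddCircle, |f x| := Real.iSup_nonneg fun _ => abs_nonneg _
  rw [norm_def]
  linarith

theorem abs_sub_apply_le_norm (f g : C1Circle) (p : UnitAddCircle) : |g p - f p| ≤ ‖g - f‖ :=
  abs_apply_le_norm (g - f) p

theorem derivative_sub (f g : C1Circle) (p : UnitAddCircle) :
    (g - f).derivative p = g.derivative p - f.derivative p := by
  rw [sub_eq_add_neg, derivative_add, derivative_neg, sub_eq_add_neg]

theorem abs_sub_derivative_le_norm (f g : C1Circle) (p : UnitAddCircle) :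
    |g.derivative p - f.derivative p| ≤ ‖g - f‖ := by
  rw [← derivative_sub]
  exact abs_derivative_le_norm (g - f) p

theorem hasDerivAt_coe (f : C1Circle) (t : ℝ) :
    HasDerivAt (fun t : ℝ => f (t : UnitAddCircle)) (f.derivative t) t := by
  rw [derivative_coe]
  exact (f.2.differentiable (by norm_num) t).hasDerivAt

theorem lipschitzWith_coe (f : C1Circle) :
    LipschitzWith ‖f‖₊ fun t : ℝ => f (t : UnitAddCircle) :=
  lipschitzWith_of_nnnorm_deriv_le (fun t => (f.hasDerivAt_coe t).differentiableAt) fun t => by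
    rw [(f.hasDerivAt_coe t).deriv]
    exact f.abs_derivative_le_norm t

end C1Circle

open C1Circle

theorem exists_isSolution (f : C1Circle) (p : UnitAddCircle) :
    ∃ γ, IsSolution f γ ∧ γ 0 = p := by
  induction p using QuotientAddGroup.induction_on with
  | H s =>
    obtain ⟨x, hx0, hx⟩ := exists_global_solution f.lipschitzWith_coe
      (L := ‖f‖₊) (fun t => f.abs_apply_le_norm t) s
    exact ⟨fun t => x t, ⟨x, fun _ => rfl, hx⟩, by simp only [hx0]⟩

/-- Lifts of two solutions through the same point differ by an integer, which `f` does not see, so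
uniqueness on `ℝ` descends to the circle. -/
theorem IsSolution.eq_of_apply_zero_eq {f : C1Circle} {γ δ : ℝ → UnitAddCircle}
    (hγ : IsSolution f γ) (hδ : IsSolution f δ) (h : γ 0 = δ 0) : γ = δ := by
  obtain ⟨x, hx, hx'⟩ := hγ
  obtain ⟨y, hy, hy'⟩ := hδ
  obtain ⟨n, hn⟩ : ∃ n : ℤ, x 0 = y 0 + n := by
    rw [hx, hy, ← sub_eq_zero, ← AddCircle.coe_sub, AddCircle.coe_eq_zero_iff] at h
    obtain ⟨n, hn⟩ := h
    exact ⟨n, by simp at hn; linarith⟩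
  have hcoe : ∀ t, ((y t + n : ℝ) : UnitAddCircle) = y t := fun t => by
    rw [AddCircle.coe_add, (AddCircle.coe_eq_zero_iff (1 : ℝ) (x := (n : ℝ))).2 ⟨n, by simp⟩,
      add_zero]
  have huniq := ODE_solution_unique_univ (v := fun _ t => f (t : UnitAddCircle))
    (s := fun _ => univ) (t₀ := 0) (f := x) (g := fun t => y t + n)
    (fun _ => f.lipschitzWith_coe.lipschitzOnWith) (fun t => ⟨by simpa [hx] using hx' t, trivial⟩)
    (fun t => ⟨by rw [hcoe, ← hy]; exact (hy' t).add_const _, trivial⟩) hn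
  funext t
  rw [hx, hy, huniq, hcoe]

theorem IsSolution.comp_add_const {f : C1Circle} {γ : ℝ → UnitAddCircle} (hγ : IsSolution f γ)
    (c : ℝ) : IsSolution f fun t => γ (t + c) := by
  obtain ⟨x, hx, hx'⟩ := hγ
  exact ⟨fun t => x (t + c), fun t => hx _, fun t => (hx' (t + c)).comp_add_const t c⟩

/-! ### Topological equivalence is an equivalence relation -/

/-- Every solution of the second system is, up to a shift of time, the reparametrized image of the
solution of the first system through the corresponding point, as solutions are unique. -/
theorem TopologicallyEquivalent.symm {f g : C1Circle} (h : TopologicallyEquivalent f g) :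
    TopologicallyEquivalent g f := by
  obtain ⟨h, hh⟩ := h
  refine ⟨h.symm, fun γ hγ => ?_⟩
  obtain ⟨δ, hδ, hδ0⟩ := exists_isSolution f (h.symm (γ 0))
  obtain ⟨τ, hτ⟩ := hh δ hδ
  have heq : (fun t => h (δ (τ (t + τ.symm 0)))) = γ :=
    (hτ.comp_add_const (τ.symm 0)).eq_of_apply_zero_eq hγ (by simp [hδ0])
  refine ⟨τ.symm.trans (OrderIso.addRight (-τ.symm 0)), ?_⟩
  convert hδ using 1
  funext t
  rw [← heq]
  simp

theorem TopologicallyEquivalent.trans {f g k : C1Circle} (h₁ : TopologicallyEquivalent f g)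
    (h₂ : TopologicallyEquivalent g k) : TopologicallyEquivalent f k := by
  obtain ⟨h₁, hh₁⟩ := h₁
  obtain ⟨h₂, hh₂⟩ := h₂
  refine ⟨h₁.trans h₂, fun γ hγ => ?_⟩
  obtain ⟨τ₁, hτ₁⟩ := hh₁ γ hγ
  obtain ⟨τ₂, hτ₂⟩ := hh₂ _ hτ₁
  exact ⟨τ₂.trans τ₁, hτ₂⟩

theorem structurallyStable_iff {f : C1Circle} :
    StructurallyStable f ↔ ∃ ε > 0, ∀ g : C1Circle, ‖g - f‖ < ε → TopologicallyEquivalent f g :=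
  ⟨fun ⟨ε, hε, h⟩ => ⟨ε, hε, h ε hε le_rfl⟩,
    fun ⟨ε, hε, h⟩ => ⟨ε, hε, fun _ _ hle g hg => h g (hg.trans_le hle)⟩⟩

theorem isOpen_SS1 : IsOpen SS1 := by
  refine Metric.isOpen_iff.2 fun f hf => ?_
  obtain ⟨ε, hε, h⟩ := structurallyStable_iff.1 hf
  refine ⟨ε / 2, half_pos hε, fun g hg => structurallyStable_iff.2
    ⟨ε / 2, half_pos hε, fun k hk => ?_⟩⟩
  rw [mem_ball_iff_norm] at hg
  have hkf : ‖k - f‖ < ε := by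
    rw [← sub_add_sub_cancel k g f]
    linarith [norm_add_le (k - g) (g - f)]
  exact (h g (by linarith)).symm.trans (h k hkf)

/-! ### Homeomorphisms matching the signs of two vector fields -/

/-- Two points of the circle have lifts to `ℝ` that realize their distance. -/
theorem exists_coe_eq_abs_sub_eq_dist (p q : UnitAddCircle) :
    ∃ z w : ℝ, (z : UnitAddCircle) = p ∧ (w : UnitAddCircle) = q ∧ |z - w| = dist p q := by
  induction p using QuotientAddGroup.induction_on with
  | H x =>
    induction q using QuotientAddGroup.induction_on with
    | H y =>
      refine ⟨x - round (x - y), y, ?_, rfl, ?_⟩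
      · rw [AddCircle.coe_sub, (AddCircle.coe_eq_zero_iff (1 : ℝ)
          (x := (round (x - y) : ℝ))).2 ⟨round (x - y), by simp⟩, sub_zero]
      · change _ = dist (x : UnitAddCircle) (y : UnitAddCircle)
        rw [dist_eq_norm, ← AddCircle.coe_sub, UnitAddCircle.norm_eq]
        congr 1
        ring

theorem dist_coe_le (x y : ℝ) : dist (x : UnitAddCircle) (y : UnitAddCircle) ≤ |x - y| := by
  rw [dist_eq_norm, ← AddCircle.coe_sub, UnitAddCircle.norm_eq]
  simpa using round_le (x - y) 0

section Shift

variable {s : UnitAddCircle → ℝ}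

theorem strictMono_add_shift (hs : LipschitzWith (1 / 2) s) :
    StrictMono fun x : ℝ => x + s (x : UnitAddCircle) := by
  intro x y hxy
  have h1 := hs.dist_le_mul (x : UnitAddCircle) (y : UnitAddCircle)
  have h2 := dist_coe_le x y
  rw [Real.dist_eq] at h1
  rw [abs_sub_comm, abs_of_pos (sub_pos.2 hxy)] at h2
  have h3 := (le_abs_self _).trans h1
  push_cast at h3
  dsimp only
  linarith

theorem surjective_add_shift (hs : Continuous s) :
    Function.Surjective fun x : ℝ => x + s (x : UnitAddCircle) := by
  intro y
  obtain ⟨C, hC⟩ := bddAbove_abs hs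
  have hC' : ∀ p, |s p| ≤ C := fun p => hC ⟨p, rfl⟩
  have hcont : Continuous fun x : ℝ => x + s (x : UnitAddCircle) :=
    continuous_id.add (hs.comp (AddCircle.continuous_mk' 1))
  refine mem_range_of_exists_le_of_exists_ge hcont ⟨y - C, ?_⟩ ⟨y + C, ?_⟩
  · linarith [(abs_le.1 (hC' ((y - C : ℝ) : UnitAddCircle))).2]
  · linarith [(abs_le.1 (hC' ((y + C : ℝ) : UnitAddCircle))).1]

/-- A shift `p ↦ p + s p` by a function with Lipschitz constant `1 / 2` is a bijection of the
circle: it lifts to an increasing homeomorphism of `ℝ` that commutes with integer translations. -/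
theorem bijective_circle_shift (hs : LipschitzWith (1 / 2) s) :
    Function.Bijective fun p : UnitAddCircle => p + (s p : UnitAddCircle) := by
  constructor
  · intro p q hpq
    induction p using QuotientAddGroup.induction_on with
    | H x =>
      induction q using QuotientAddGroup.induction_on with
      | H y =>
        change (x : UnitAddCircle) + (s (x : UnitAddCircle) : UnitAddCircle)
          = (y : UnitAddCircle) + (s (y : UnitAddCircle) : UnitAddCircle) at hpq
        change (x : UnitAddCircle) = (y : UnitAddCircle)
        rw [← AddCircle.coe_add, ← AddCircle.coe_add, ← sub_eq_zero, ← AddCircle.coe_sub,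
          AddCircle.coe_eq_zero_iff] at hpq
        obtain ⟨n, hn⟩ := hpq
        have hy : ((y + n : ℝ) : UnitAddCircle) = y := by
          rw [AddCircle.coe_add,
            (AddCircle.coe_eq_zero_iff (1 : ℝ) (x := (n : ℝ))).2 ⟨n, by simp⟩, add_zero]
        have hxy : x = y + n := (strictMono_add_shift hs).injective (by
          simp only [hy]
          simp only [zsmul_eq_mul, mul_one] at hn
          linarith)
        rw [hxy, hy]
  · intro q
    induction q using QuotientAddGroup.induction_on with
    | H y =>
      obtain ⟨x, hx⟩ := surjective_add_shift hs.continuous y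
      refine ⟨x, ?_⟩
      change _ = (y : UnitAddCircle)
      rw [← hx, AddCircle.coe_add]

/-- A shift that matches the signs of two vector fields is a topological equivalence. -/
theorem topologicallyEquivalent_of_sign_eq {f g : C1Circle} (hs : LipschitzWith (1 / 2) s)
    (hsign : ∀ p, SignType.sign (g (p + (s p : UnitAddCircle))) = SignType.sign (f p)) :
    TopologicallyEquivalent f g := by
  have hcont : Continuous fun p : UnitAddCircle => p + (s p : UnitAddCircle) :=
    continuous_id.add ((AddCircle.continuous_mk' 1).comp hs.continuous)
  refine ⟨Continuous.homeoOfEquivCompactToT2 (f := Equiv.ofBijective _ (bijective_circle_shift hs))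
    hcont, ?_⟩
  rintro γ ⟨x, hx, hx'⟩
  let H : ℝ ≃o ℝ := (strictMono_add_shift hs).orderIsoOfSurjective _
    (surjective_add_shift hs.continuous)
  have hH : ∀ t : ℝ, (H t : UnitAddCircle) = (t : UnitAddCircle) + (s t : UnitAddCircle) :=
    fun t => AddCircle.coe_add _ _ _
  obtain ⟨y, hy0, hy⟩ := exists_global_solution g.lipschitzWith_coe
    (L := ‖g‖₊) (fun t => g.abs_apply_le_norm t) (H (x 0))
  obtain ⟨τ, hτ⟩ := exists_reparametrization f.lipschitzWith_coe g.lipschitzWith_coe H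
    (fun p => by rw [hH, hsign]) (fun t => by simpa only [hx] using hx' t) hy hy0
  have heq : ∀ t, γ (τ t) + (s (γ (τ t)) : UnitAddCircle) = y t := fun t => by
    rw [← hτ, hH, hx]
  exact ⟨τ, y, heq, fun t => by
    change HasDerivAt y (g (γ (τ t) + (s (γ (τ t)) : UnitAddCircle))) t
    rw [heq]
    exact hy t⟩

end Shift

/-! ### Functions of one variable whose derivative is bounded away from zero -/

theorem exists_eq_zero_of_le_deriv {Φ Φ' : ℝ → ℝ} {m ρ x : ℝ} (hΦ : ∀ t, HasDerivAt Φ (Φ' t) t)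
    (hρ : 0 ≤ ρ) (hm : ∀ t ∈ Icc (x - ρ) (x + ρ), m ≤ Φ' t) (hx : |Φ x| ≤ m * ρ) :
    ∃ z, |z - x| ≤ ρ ∧ Φ z = 0 := by
  have hc : Continuous Φ := continuous_iff_continuousAt.2 fun t => (hΦ t).continuousAt
  have hgrow := (convex_Icc (x - ρ) (x + ρ)).mul_sub_le_image_sub_of_le_deriv hc.continuousOn
    (fun t _ => (hΦ t).differentiableAt.differentiableWithinAt) (C := m)
    (fun t ht => by rw [(hΦ t).deriv]; exact hm t (interior_subset ht))
  have hxm : x ∈ Icc (x - ρ) (x + ρ) := ⟨by linarith, by linarith⟩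
  have h1 := hgrow (x - ρ) ⟨le_rfl, by linarith⟩ x hxm (by linarith)
  have h2 := hgrow x hxm (x + ρ) ⟨by linarith, le_rfl⟩ (by linarith)
  rw [sub_sub_cancel] at h1
  rw [add_sub_cancel_left] at h2
  obtain ⟨h3, h4⟩ := abs_le.1 hx
  obtain ⟨z, hz, hz0⟩ := intermediate_value_Icc (by linarith : x - ρ ≤ x + ρ) hc.continuousOn
    (⟨by linarith, by linarith⟩ : (0 : ℝ) ∈ Icc (Φ (x - ρ)) (Φ (x + ρ)))
  exact ⟨z, abs_le.2 ⟨by linarith [hz.1], by linarith [hz.2]⟩, hz0⟩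

theorem exists_eq_zero_of_deriv {Φ Φ' : ℝ → ℝ} {m ρ x : ℝ} (hΦ : ∀ t, HasDerivAt Φ (Φ' t) t)
    (hρ : 0 ≤ ρ) (hm : (∀ t ∈ Icc (x - ρ) (x + ρ), m ≤ Φ' t) ∨
      ∀ t ∈ Icc (x - ρ) (x + ρ), Φ' t ≤ -m) (hx : |Φ x| ≤ m * ρ) :
    ∃ z, |z - x| ≤ ρ ∧ Φ z = 0 := by
  rcases hm with hm | hm
  · exact exists_eq_zero_of_le_deriv hΦ hρ hm hx
  · obtain ⟨z, hz, hz0⟩ := exists_eq_zero_of_le_deriv (fun t => (hΦ t).neg) hρ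
      (fun t ht => le_neg_of_le_neg (hm t ht)) (by simpa using hx)
    exact ⟨z, hz, neg_eq_zero.1 hz0⟩

theorem strictMonoOn_Icc_of_hasDerivAt_pos {Φ Φ' : ℝ → ℝ} {a b : ℝ}
    (hΦ : ∀ t, HasDerivAt Φ (Φ' t) t) (hpos : ∀ t ∈ Icc a b, 0 < Φ' t) :
    StrictMonoOn Φ (Icc a b) :=
  strictMonoOn_of_deriv_pos (convex_Icc a b)
    (continuous_iff_continuousAt.2 fun t => (hΦ t).continuousAt).continuousOn
    fun t ht => by rw [(hΦ t).deriv]; exact hpos t (interior_subset ht)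

theorem sign_eq_sign_sub_of_strictMonoOn {Φ : ℝ → ℝ} {I : Set ℝ} (hΦ : StrictMonoOn Φ I) {z x : ℝ}
    (hz : z ∈ I) (hx : x ∈ I) (hz0 : Φ z = 0) :
    SignType.sign (Φ x) = SignType.sign (x - z) := by
  rcases lt_trichotomy x z with h | rfl | h
  · rw [sign_neg (hz0 ▸ hΦ hx hz h), sign_neg (sub_neg.2 h)]
  · rw [hz0, sub_self]
  · rw [sign_pos (hz0 ▸ hΦ hz hx h), sign_pos (sub_pos.2 h)]

/-! ### Fields with simple zeros are structurally stable -/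

/-- If all zeros of `f` are simple then, by compactness, where `f` is small its derivative is
bounded away from zero on intervals of a uniform length. -/
theorem exists_uniform_slope {f : C1Circle} (hf : ∀ p, f p = 0 → f.derivative p ≠ 0) :
    ∃ η > 0, ∃ r > 0, ∀ x : ℝ, |f (x : UnitAddCircle)| ≤ η →
      (∀ t ∈ Icc (x - r) (x + r), η ≤ f.derivative (t : UnitAddCircle)) ∨
        ∀ t ∈ Icc (x - r) (x + r), f.derivative (t : UnitAddCircle) ≤ -η := by
  obtain ⟨p₀, -, hp₀⟩ := isCompact_univ.exists_isMinOn (univ_nonempty (α := UnitAddCircle))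
    (f.continuous_toFun.abs.add f.continuous_derivative.abs).continuousOn
  have hmin : ∀ p, |f p₀| + |f.derivative p₀| ≤ |f p| + |f.derivative p| :=
    fun p => hp₀ (mem_univ p)
  set m := |f p₀| + |f.derivative p₀|
  have hm : 0 < m := by
    rcases eq_or_ne (f p₀) 0 with h | h
    · exact add_pos_of_nonneg_of_pos (abs_nonneg _) (abs_pos.2 (hf p₀ h))
    · exact add_pos_of_pos_of_nonneg (abs_pos.2 h) (abs_nonneg _)
  obtain ⟨r, hr, hunif⟩ := Metric.uniformContinuous_iff.1
    (CompactSpace.uniformContinuous_of_continuous f.continuous_derivative) (m / 2) (by linarith)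
  refine ⟨m / 4, by linarith, r / 2, by linarith, fun x hx => ?_⟩
  have hclose : ∀ t ∈ Icc (x - r / 2) (x + r / 2),
      |f.derivative (t : UnitAddCircle) - f.derivative (x : UnitAddCircle)| < m / 2 := by
    intro t ht
    refine hunif ((dist_coe_le t x).trans_lt ?_)
    rw [abs_lt]
    constructor <;> linarith [ht.1, ht.2]
  have hx' : 3 * m / 4 ≤ |f.derivative (x : UnitAddCircle)| := by
    linarith [hmin (x : UnitAddCircle)]
  rcases le_abs.1 hx' with h | h
  · exact Or.inl fun t ht => by linarith [(abs_lt.1 (hclose t ht)).1]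
  · exact Or.inr fun t ht => by linarith [(abs_lt.1 (hclose t ht)).2]

/-- A vector field whose zeros are simple is structurally stable. Each zero `p` of `f` has exactly
one zero `p + σ p` of a nearby field `g` close to it. As the zeros of `f` are separated, the shift
`σ` is `1 / 2`-Lipschitz on them, and so it extends to a small `1 / 2`-Lipschitz function on the
circle. The shift by this function matches the signs of `f` and `g`. -/
theorem structurallyStable_of_simple_zeros {f : C1Circle}
    (hf : ∀ p, f p = 0 → f.derivative p ≠ 0) : StructurallyStable f := by
  obtain ⟨η, hη, r, hr, hslope⟩ := exists_uniform_slope hf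
  -- Where `|f| < c`, there is a zero of `f` at distance at most `r / 2`.
  let c := min η (η * (r / 2))
  have hc : 0 < c := lt_min hη (by positivity)
  -- The bound on the shift: small enough not to change the sign of `f` where `c ≤ |f|`.
  let δ := min (r / 4) (c / (2 * (‖f‖ + 1)))
  have hδ : 0 < δ := lt_min (by positivity) (by positivity)
  have hδr : δ ≤ r / 4 := min_le_left _ _
  have hδc : ‖f‖ * δ ≤ c / 2 := by
    have h1 : δ ≤ c / (2 * (‖f‖ + 1)) := min_le_right _ _
    rw [le_div_iff₀ (by positivity)] at h1
    nlinarith [norm_nonneg f]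
  refine structurallyStable_iff.2 ⟨min (c / 2) (min (η / 2) (η / 2 * δ)),
    lt_min (by positivity) (lt_min (by positivity) (by positivity)), fun g hg => ?_⟩
  obtain ⟨hgc, hg⟩ := lt_min_iff.1 hg
  obtain ⟨hgη, hgδ⟩ := lt_min_iff.1 hg
  have hslope_g : ∀ x : ℝ, |f (x : UnitAddCircle)| ≤ η →
      (∀ t ∈ Icc (x - r) (x + r), η / 2 ≤ g.derivative (t : UnitAddCircle)) ∨
        ∀ t ∈ Icc (x - r) (x + r), g.derivative (t : UnitAddCircle) ≤ -(η / 2) := by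
    intro x hx
    have hd := fun t : ℝ => abs_le.1 (abs_sub_derivative_le_norm f g (t : UnitAddCircle))
    exact (hslope x hx).imp (fun h t ht => by linarith [h t ht, (hd t).1])
      (fun h t ht => by linarith [h t ht, (hd t).2])
  have zero_near : ∀ p, ∃ u : ℝ, f p = 0 → |u| ≤ δ ∧ g (p + (u : UnitAddCircle)) = 0 := by
    intro p
    by_cases hp : f p = 0
    swap
    · exact ⟨0, fun h => absurd h hp⟩
    induction p using QuotientAddGroup.induction_on with
    | H z =>
      have hz : f (z : UnitAddCircle) = 0 := hp
      have hsub : Icc (z - δ) (z + δ) ⊆ Icc (z - r) (z + r) :=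
        Icc_subset_Icc (by linarith) (by linarith)
      have hgz := abs_sub_apply_le_norm f g (z : UnitAddCircle)
      rw [hz, sub_zero] at hgz
      obtain ⟨w, hw, hw0⟩ := exists_eq_zero_of_deriv g.hasDerivAt_coe hδ.le
        ((hslope_g z (by simp [hz, hη.le])).imp (fun h t ht => h t (hsub ht))
          (fun h t ht => h t (hsub ht))) (hgz.trans hgδ.le)
      refine ⟨w - z, fun _ => ⟨hw, ?_⟩⟩
      change g ((z : UnitAddCircle) + ((w - z : ℝ) : UnitAddCircle)) = 0
      rw [← AddCircle.coe_add, add_sub_cancel, hw0]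
  choose σ hσ using zero_near
  have separated : ∀ p q, f p = 0 → f q = 0 → p ≠ q → r ≤ dist p q := by
    intro p q hp hq hpq
    by_contra! hlt
    obtain ⟨z, w, rfl, rfl, hzw⟩ := exists_coe_eq_abs_sub_eq_dist p q
    rw [← hzw, abs_lt] at hlt
    have hzI : z ∈ Icc (z - r) (z + r) := ⟨by linarith, by linarith⟩
    have hwI : w ∈ Icc (z - r) (z + r) := ⟨by linarith, by linarith⟩
    have hinj : InjOn (fun t : ℝ => f (t : UnitAddCircle)) (Icc (z - r) (z + r)) := by
      rcases hslope z (by simp [hp, hη.le]) with h | h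
      · exact (strictMonoOn_Icc_of_hasDerivAt_pos f.hasDerivAt_coe
          fun t ht => hη.trans_le (h t ht)).injOn
      · exact fun a ha b hb hab => (strictMonoOn_Icc_of_hasDerivAt_pos
          (fun t => (f.hasDerivAt_coe t).neg) fun t ht => by linarith [h t ht]).injOn ha hb
            (congrArg Neg.neg hab)
    exact hpq (congrArg _ (hinj hzI hwI (hp.trans hq.symm)))
  have hσlip : LipschitzOnWith (1 / 2) σ {p | f p = 0} := by
    refine LipschitzOnWith.of_dist_le_mul fun p hp q hq => ?_
    rcases eq_or_ne p q with rfl | hpq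
    · simp
    · have h1 := abs_le.1 (hσ p hp).1
      have h2 := abs_le.1 (hσ q hq).1
      have h3 := separated p q hp hq hpq
      push_cast
      rw [Real.dist_eq, abs_le]
      constructor <;> linarith
  obtain ⟨s₀, hs₀, hs₀σ⟩ := hσlip.extend_real
  let s : UnitAddCircle → ℝ := fun p => max (-δ) (min δ (s₀ p))
  have hs : LipschitzWith (1 / 2) s := (hs₀.const_min δ).const_max (-δ)
  have hsδ : ∀ p, |s p| ≤ δ := fun p =>
    abs_le.2 ⟨le_max_left _ _, max_le (by linarith) (min_le_left _ _)⟩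
  have hsσ : ∀ p, f p = 0 → s p = σ p := by
    intro p hp
    have h := abs_le.1 (hσ p hp).1
    have h' : s₀ p = σ p := (hs₀σ hp).symm
    simp only [s, h', min_eq_right h.2, max_eq_right h.1]
  refine topologicallyEquivalent_of_sign_eq hs fun p => ?_
  induction p using QuotientAddGroup.induction_on with
  | H x =>
    change SignType.sign (g ((x : UnitAddCircle) + (s (x : UnitAddCircle) : UnitAddCircle)))
      = SignType.sign (f (x : UnitAddCircle))
    rw [← AddCircle.coe_add]
    have hsx := abs_le.1 (hsδ (x : UnitAddCircle))
    rcases lt_or_ge |f (x : UnitAddCircle)| c with hx | hx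
    · have hslope_x := hslope x (hx.le.trans (min_le_left _ _))
      have hsub : Icc (x - r / 2) (x + r / 2) ⊆ Icc (x - r) (x + r) :=
        Icc_subset_Icc (by linarith) (by linarith)
      obtain ⟨z, hz, hz0⟩ := exists_eq_zero_of_deriv f.hasDerivAt_coe (half_pos hr).le
        (hslope_x.imp (fun h t ht => h t (hsub ht)) (fun h t ht => h t (hsub ht)))
        (hx.le.trans (min_le_right _ _))
      have hgz : g ((z + s (z : UnitAddCircle) : ℝ) : UnitAddCircle) = 0 := by
        rw [AddCircle.coe_add, hsσ _ hz0]
        exact (hσ _ hz0).2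
      have hsz := abs_le.1 (hsδ (z : UnitAddCircle))
      have hz' := abs_le.1 hz
      have hxI : x ∈ Icc (x - r) (x + r) := ⟨by linarith, by linarith⟩
      have hzI : z ∈ Icc (x - r) (x + r) := ⟨by linarith, by linarith⟩
      have hHxI : x + s (x : UnitAddCircle) ∈ Icc (x - r) (x + r) :=
        ⟨by linarith, by linarith⟩
      have hHzI : z + s (z : UnitAddCircle) ∈ Icc (x - r) (x + r) :=
        ⟨by linarith, by linarith⟩
      have hH : SignType.sign (x + s (x : UnitAddCircle) - (z + s (z : UnitAddCircle)))
          = SignType.sign (x - z) := by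
        have := sign_eq_sign_sub_of_strictMonoOn
          (Φ := fun t : ℝ => t + s (t : UnitAddCircle) - (z + s (z : UnitAddCircle))) (I := univ)
          (fun a _ b _ hab => sub_lt_sub_right (strictMono_add_shift hs hab) _)
          (mem_univ z) (mem_univ x) (sub_self _)
        exact this
      have hd : ∀ t ∈ Icc (x - r) (x + r),
          |g.derivative (t : UnitAddCircle) - f.derivative (t : UnitAddCircle)| < η / 2 :=
        fun t _ => (abs_sub_derivative_le_norm f g _).trans_lt hgη
      rcases hslope_x with h | h
      · have hgpos : ∀ t ∈ Icc (x - r) (x + r), 0 < g.derivative (t : UnitAddCircle) :=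
          fun t ht => by linarith [h t ht, (abs_lt.1 (hd t ht)).1]
        rw [sign_eq_sign_sub_of_strictMonoOn (strictMonoOn_Icc_of_hasDerivAt_pos f.hasDerivAt_coe
            fun t ht => hη.trans_le (h t ht)) hzI hxI hz0,
          sign_eq_sign_sub_of_strictMonoOn (strictMonoOn_Icc_of_hasDerivAt_pos g.hasDerivAt_coe
            hgpos) hHzI hHxI hgz, hH]
      · have hgneg : ∀ t ∈ Icc (x - r) (x + r), 0 < -g.derivative (t : UnitAddCircle) :=
          fun t ht => by linarith [h t ht, (abs_lt.1 (hd t ht)).2]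
        have h1 := sign_eq_sign_sub_of_strictMonoOn (strictMonoOn_Icc_of_hasDerivAt_pos
          (fun t => (f.hasDerivAt_coe t).fun_neg) fun t ht => by linarith [h t ht]) hzI hxI
          (neg_eq_zero.2 hz0)
        have h2 := sign_eq_sign_sub_of_strictMonoOn (strictMonoOn_Icc_of_hasDerivAt_pos
          (fun t => (g.hasDerivAt_coe t).fun_neg) hgneg) hHzI hHxI (neg_eq_zero.2 hgz)
        rw [hH, ← h1, Left.sign_neg, Left.sign_neg] at h2
        exact neg_injective h2
    · have h1 := abs_le.1 (abs_sub_apply_le_norm f g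
        ((x + s (x : UnitAddCircle) : ℝ) : UnitAddCircle))
      have h2 := f.lipschitzWith_coe.dist_le_mul (x + s (x : UnitAddCircle)) x
      rw [Real.dist_eq, Real.dist_eq, add_sub_cancel_left, coe_nnnorm] at h2
      have h3 := abs_le.1 (h2.trans ((mul_le_mul_of_nonneg_left (hsδ (x : UnitAddCircle))
        (norm_nonneg f)).trans hδc))
      rcases le_abs.1 hx with h | h
      · rw [sign_pos (by linarith : 0 < f (x : UnitAddCircle)), sign_pos (by linarith)]
      · rw [sign_neg (by linarith : f (x : UnitAddCircle) < 0), sign_neg (by linarith)]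

/-! ### Fields with simple zeros are dense -/

/-- Almost every value of a `C¹` function is regular by Sard's theorem, and `v` is a regular value
of `f` if and only if all zeros of `f - v` are simple. -/
theorem dense_SS1 : Dense SS1 := by
  refine Metric.dense_iff.2 fun f ε hε => ?_
  have hsard : volume ((fun t : ℝ => f (t : UnitAddCircle)) ''
      {t : ℝ | f.derivative (t : UnitAddCircle) = 0}) = 0 := by
    refine addHaar_image_eq_zero_of_det_fderivWithin_eq_zero volume
      (f' := fun _ => (0 : ℝ →L[ℝ] ℝ)) (fun t ht => ?_) (fun _ _ => ?_)
    · have h := f.hasDerivAt_coe t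
      rw [show f.derivative (t : UnitAddCircle) = 0 from ht] at h
      simpa using! h.hasFDerivAt.hasFDerivWithinAt
    · simp [ContinuousLinearMap.det]
  obtain ⟨v, hv, hreg⟩ : ∃ v ∈ Ioo 0 ε, v ∉ (fun t : ℝ => f (t : UnitAddCircle)) ''
      {t : ℝ | f.derivative (t : UnitAddCircle) = 0} := by
    by_contra! hsub
    have h := measure_mono_null hsub hsard
    rw [Real.volume_Ioo, ENNReal.ofReal_eq_zero] at h
    linarith
  let k : C1Circle := ⟨fun _ => v, contDiff_const⟩
  have hk' : ∀ p, k.derivative p = 0 := fun p => deriv_const 0 v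
  have hk : ‖k‖ = v := by
    have h : ∀ p, k p = v := fun _ => rfl
    simp [norm_def, hk', h, abs_of_pos hv.1]
  refine ⟨f - k, ?_, structurallyStable_of_simple_zeros fun p hp hp' => hreg ?_⟩
  · rw [mem_ball_iff_norm, sub_sub_cancel_left, norm_neg, hk]
    exact hv.2
  · rw [derivative_sub, hk', sub_zero] at hp'
    induction p using QuotientAddGroup.induction_on with
    | H x => exact ⟨x, hp', sub_eq_zero.1 hp⟩

end CircleDynamics

/-- The set of `C¹` structurally stable systems is open and dense in `C¹(𝕊¹)` with the `C¹` norm. -/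
theorem theorem2 :
    IsOpen CircleDynamics.SS1 ∧ Dense CircleDynamics.SS1 :=
  ⟨CircleDynamics.isOpen_SS1, CircleDynamics.dense_SS1⟩
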